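/- Let $P$ be a row-stochastic $n\times n$ real matrix ($n\ge 1$) that is proper, i.e. has no eigenvalue of modulus $1$ other than $1$; then $P^\infty=\lim_{k\to\infty}P^k$ exists. Let $\Gamma$ be the weighted digraph on $\{1,\dots,n\}$ that has an arc $(j,i)$, of weight $p_{ij}$, whenever $p_{ij}>0$, and let $L=(\ell_{ij})$ be its Kirchhoff matrix: $\ell_{ij}=-p_{ij}$ if $j\ne i$ and $(j,i)$ is an arc, $\ell_{ij}=0$ for the other $j\ne i$, and $\ell_{ii}=-\sum_{k\ne i}\ell_{ik}$. Assume that all agents (vertices) are basic, i.e. that no arc of $\Gamma$ enters a bicomponent (strong component) from outside. Let $\nu$ be the number of bicomponents, and let the vertices be numbered so that those of the first bicomponent come first, then those of the second one, and so on; $c(g)$ is the number of the bicomponent containing $g$. Let $T_P$ be the subspace of all $x\in\mathbb R^n$ such that $P^\infty x$ has equal components, and let $S$ be the matrix of the orthogonal projection (for the Euclidean inner product) of $\mathbb R^n$ onto $T_P$. All rows of $P^\infty S$ coincide: $P^\infty S=\mathbf 1\alpha^{\mathrm T}$, where $\mathbf 1=(1,\dots,1)^{\mathrm T}$ and $\alpha\in\mathbb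 R^n$ is the weight vector of the orthogonal projection procedure. Let $P_i$ be the submatrix of $P$ that corresponds to the $i$th bicomponent. Then $\lim_{k\to\infty}P_i^k=\mathbf 1(\pi^i)^{\mathrm T}$ for a vector $\pi^i$; let $\tilde\pi^i\in\mathbb R^n$ be $\pi^i$ supplemented by zeros outside the $i$th bicomponent. Let $Z$ be the matrix obtained from $L$ by replacing the first column by $\mathbf 1$ and, for $i=2,\dots,\nu$, the column of the first vertex of the $i$th bicomponent by $\tilde\pi^{i-1}-\tilde\pi^i$. The matrix $Z$ is nonsingular. The following assertions hold. 1. The row vector $\alpha^{\mathrm T}$ coincides with the first row of $Z^{-1}$. 2. All components of $\alpha$ are positive and $\sum_{i=1}^n\alpha_i=1$. The sum of the entries in any row of $Z^{-1}$, except for the first row, is $0$. 3. For all $g,h\in\{1,\dots,n\}$, $$\frac{\alpha_g}{\alpha_h}=\frac{\beta_{c(g)}\,\tilde\pi^{c(g)}_g}{\beta_{c(h)}\,\tilde\pi^{c(h)}_h},\qquad \beta_i=\frac{(t^i)^2}{\sum_l (t^i_l)^2},$$ where $t^i$ is the total weight of all spanning out-trees of the $i$th bicomponent of $\Gamma$,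 $t^i_l$ is the total weight of those of them that are rooted at $l$, and $l$ runs over the vertices of the $i$th bicomponent. (The weight of an out-tree is the product of the weights of its arcs; an empty product is $1$.) -/

import Mathlib

open Filter Topology

noncomputable section

namespace Consensus

section Digraphs

variable {V : Type*}

/-- The communication digraph of an influence matrix `P`: it has the arc `(j, i)` (agent `j`
influences agent `i`) whenever `0 < P i j`. -/
def commDigraph (P : Matrix V V ℝ) : Digraph V where
  Adj j i := 0 < P i j

/-- The weight of the arc `(j, i)` of the communication digraph is `P i j`. -/
def arcWeight (P : Matrix V V ℝ) (j i : V) : ℝ := P i j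

open Classical in
/-- The Kirchhoff matrix of the communication digraph: off the diagonal the entry `(i, j)` is minus
the weight of the arc `(j, i)` if there is such an arc and `0` otherwise; row sums are zero. -/
def kirchhoff [Fintype V] [DecidableEq V] (P : Matrix V V ℝ) : Matrix V V ℝ :=
  let offDiag : V → V → ℝ := fun i j => if (commDigraph P).Adj j i then -arcWeight P j i else 0
  Matrix.of fun i j =>
    if i = j then -∑ k ∈ Finset.univ.erase i, offDiag i k else offDiag i j

/-- `v` is reachable from `u` along a directed path (possibly of length zero). -/
def Reachable (G : Digraph V) (u v : V) : Prop := Relation.ReflTransGen G.Adj u v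

/-- `u` and `v` lie in the same bicomponent (strong component). -/
def SameBicomponent (G : Digraph V) (u v : V) : Prop := Reachable G u v ∧ Reachable G v u

/-- `v` is basic: no arc enters the bicomponent of `v` from outside. -/
def IsBasic (G : Digraph V) (v : V) : Prop :=
  ∀ j i, G.Adj j i → SameBicomponent G i v → SameBicomponent G j v

/-- The arc set `A` is a spanning out-tree (arborescence) of `G` rooted at `r`: it consists of arcs
of `G`, no arc of it enters `r`, exactly one enters each other vertex, and every vertex is
reachable from `r` along arcs of `A`. -/
def IsSpanningOutTree (G : Digraph V) (A : Finset (V × V)) (r : V) : Prop :=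
  (∀ a ∈ A, G.Adj a.1 a.2) ∧
  (∀ u, (u, r) ∉ A) ∧
  (∀ v, v ≠ r → ∃! u, (u, v) ∈ A) ∧
  (∀ v, Relation.ReflTransGen (fun x y => (x, y) ∈ A) r v)

/-- The weight of a set of arcs is the product of the weights of the arcs. -/
def treeWeight (P : Matrix V V ℝ) (A : Finset (V × V)) : ℝ := ∏ a ∈ A, arcWeight P a.1 a.2

open Classical in
/-- Total weight of the spanning out-trees rooted at `r`. -/
def rootedTreeWeight [Fintype V] (P : Matrix V V ℝ) (r : V) : ℝ :=
  ∑ A : Finset (V × V) with IsSpanningOutTree (commDigraph P) A r, treeWeight P A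

open Classical in
/-- Total weight of all spanning out-trees. -/
def totalTreeWeight [Fintype V] (P : Matrix V V ℝ) : ℝ :=
  ∑ A : Finset (V × V) with ∃ r, IsSpanningOutTree (commDigraph P) A r, treeWeight P A

end Digraphs

section Procedure

variable {V : Type*} [Fintype V] [DecidableEq V]

/-- `P` is proper: it has no eigenvalue of modulus `1` other than `1`. -/
def IsProper (P : Matrix V V ℝ) : Prop :=
  ∀ μ ∈ spectrum ℂ (P.map Complex.ofReal), ‖μ‖ = 1 → μ = 1

/-- The power limit `P^∞ = lim P ^ k` (meaningful when the powers converge). -/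
def powLimit (P : Matrix V V ℝ) : Matrix V V ℝ := limUnder atTop fun k : ℕ => P ^ k

/-- The region of convergence to consensus: the subspace of the vectors that `P^∞` transforms into
vectors with equal components. -/
def consensusRegion (P : Matrix V V ℝ) : Submodule ℝ (EuclideanSpace ℝ V) where
  carrier := {x | ∀ i j, (powLimit P).mulVec x.ofLp i = (powLimit P).mulVec x.ofLp j}
  add_mem' := by
    intro x y hx hy i j
    simp only [WithLp.ofLp_add, Matrix.mulVec_add, Pi.add_apply]
    rw [hx i j, hy i j]
  zero_mem' := by
    intro i j
    simp
  smul_mem' := by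
    intro a x hx i j
    simp only [WithLp.ofLp_smul, Matrix.mulVec_smul, Pi.smul_apply]
    rw [hx i j]

/-- The matrix `S` of the (Euclidean) orthogonal projection onto the region of convergence. -/
def projMatrix (P : Matrix V V ℝ) : Matrix V V ℝ :=
  (Matrix.toEuclideanCLM (n := V) (𝕜 := ℝ)).symm (consensusRegion P).starProjection

/-- The resulting matrix `P^∞ S` of the orthogonal projection procedure. -/
def resultingMatrix (P : Matrix V V ℝ) : Matrix V V ℝ := powLimit P * projMatrix P

end Procedure

section Blocks

variable {n ν : ℕ}

/-- A numbering of the agents by bicomponents: `c v` is the (zero-based) number of the bicomponent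
of `v`, all `ν` numbers occur, and the vertices of the first bicomponent come first, then those of
the second one, and so on. -/
structure BicomponentNumbering (P : Matrix (Fin n) (Fin n) ℝ) (ν : ℕ) where
  c : Fin n → Fin ν
  surjective : Function.Surjective c
  monotone : Monotone c
  eq_iff : ∀ g h, c g = c h ↔ SameBicomponent (commDigraph P) g h

variable {P : Matrix (Fin n) (Fin n) ℝ}

namespace BicomponentNumbering

/-- The vertex set of the `i`th bicomponent. -/
abbrev Class (N : BicomponentNumbering P ν) (i : Fin ν) : Type := {v : Fin n // N.c v = i}

/-- The influence matrix `P_i` of the `i`th bicomponent. -/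
def block (N : BicomponentNumbering P ν) (i : Fin ν) : Matrix (N.Class i) (N.Class i) ℝ :=
  P.submatrix Subtype.val Subtype.val

theorem class_nonempty (N : BicomponentNumbering P ν) (i : Fin ν) :
    (Finset.univ.filter fun v => N.c v = i).Nonempty := by
  obtain ⟨v, hv⟩ := N.surjective i
  exact ⟨v, by simp [hv]⟩

/-- The first vertex of the `i`th bicomponent. -/
def first (N : BicomponentNumbering P ν) (i : Fin ν) : Fin n :=
  (Finset.univ.filter fun v => N.c v = i).min' (N.class_nonempty i)

theorem c_first (N : BicomponentNumbering P ν) (i : Fin ν) : N.c (N.first i) = i :=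
  (Finset.mem_filter.mp (Finset.min'_mem _ (N.class_nonempty i))).2

/-- The vector `π^i`: a row (say, the first one) of `P_i^∞`. -/
def pi (N : BicomponentNumbering P ν) (i : Fin ν) : N.Class i → ℝ :=
  fun v => powLimit (N.block i) ⟨N.first i, N.c_first i⟩ v

/-- `π^i` supplemented by zeros outside the `i`th bicomponent. -/
def piTilde (N : BicomponentNumbering P ν) (i : Fin ν) : Fin n → ℝ :=
  fun v => if h : N.c v = i then N.pi i ⟨v, h⟩ else 0

/-- The difference of the extended vectors of the bicomponent preceding the `i`th one and of the
`i`th one (used only if `i` is not the first bicomponent). -/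
def q (N : BicomponentNumbering P ν) (i : Fin ν) : Fin n → ℝ :=
  N.piTilde ⟨(i : ℕ) - 1, lt_of_le_of_lt (Nat.sub_le _ _) i.isLt⟩ - N.piTilde i

/-- The Kirchhoff matrix with the first column replaced by ones and the first columns of the
blocks of the other bicomponents replaced by zeros. -/
def X (N : BicomponentNumbering P ν) : Matrix (Fin n) (Fin n) ℝ :=
  Matrix.of fun g j =>
    if j = N.first (N.c j) then (if (N.c j : ℕ) = 0 then 1 else 0) else kirchhoff P g j

/-- `X` with the zero column of the block of each bicomponent `i` other than the first one replaced
by `q i`. -/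
def Z (N : BicomponentNumbering P ν) : Matrix (Fin n) (Fin n) ℝ :=
  Matrix.of fun g j =>
    if j = N.first (N.c j) ∧ (N.c j : ℕ) ≠ 0 then N.q (N.c j) g else N.X g j

/-- `β_i = (t^i)² / ∑ l, (t^i_l)²`, with `t^i` and `t^i_l` the total weights of all spanning
out-trees of the `i`th bicomponent and of those rooted at `l`. -/
def beta (N : BicomponentNumbering P ν) (i : Fin ν) : ℝ :=
  totalTreeWeight (N.block i) ^ 2 / ∑ l : N.Class i, rootedTreeWeight (N.block i) l ^ 2

end BicomponentNumbering

end Blocks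

end Consensus

end

/-!
Since every agent is basic, an entry `P g h` can be nonzero only inside one bicomponent, so `P` is
block diagonal with irreducible row-stochastic blocks.

*The power limit.* Powers of a row-stochastic matrix are bounded. On the generalized eigenspaces
with `‖μ‖ < 1` they tend to zero, and on that of `1` boundedness excludes Jordan chains; properness
excludes the other eigenvalues of modulus `1` (`exists_tendsto_pow_apply`). By the maximum principle
the limit of the powers of an irreducible block has equal rows, and these are positive. Thus the row
`g` of `P^∞` is `π̃` of the bicomponent of `g` (`powLimit_row`), and each left fixed vector of `P` is
a combination of the `π̃ⁱ`.

*The weight vector.* The region of convergence consists of the `x` for which all `π̃ⁱ ⬝ᵥ x` agree.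
The `π̃ⁱ` have disjoint supports, so `α = γ ∑ i, π̃ⁱ / ‖π̃ⁱ‖²` satisfies `π̃ⁱ ⬝ᵥ α = γ` for all `i` and
lies in the region itself; with `γ = (∑ i, 1 / ‖π̃ⁱ‖²)⁻¹`, pairing with `α` gives the consensus value
of each vector of the region. As the orthogonal projection is self-adjoint and fixes `α`, the rows
of `P^∞ S` are all equal to `α` (`resultingMatrix_eq`).

*The matrix `Z`.* The Kirchhoff matrix is `1 - P`, so `α` annihilates its columns, and `α` is
orthogonal to the differences `π̃ⁱ⁻¹ - π̃ⁱ`; hence `αᵀ Z` is the first unit vector. A vector in the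
left kernel of `Z` is fixed by `P`, hence a combination of the `π̃ⁱ`; the other columns of `Z` make
it a multiple of `α` whose components sum to zero, that is, zero (`isUnit_det_Z`). The row sums of
`Z⁻¹` come from the column of ones.

*Trees.* By the Markov chain tree theorem (`vecMul_parentWeight`) the rooted tree weights of a block
form a stationary vector, so `tⁱ_l = tⁱ πⁱ_l` and `β_i = 1 / ‖π̃ⁱ‖²`. That theorem is proved by
counting the maps `f : V → V` whose iterates lead from everywhere to `l` in two ways: by the value of
`f` at `l`, and by the predecessor of `l` on the cycle of `f`.
-/

namespace Consensus

/-! ### Convergence of the powers of a proper stochastic matrix -/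

section PowerConvergence

/-- With `u k = (f ^ k) x` and `y k = (f ^ k) ((f - μ) x)`, this passes from a generalized
eigenvector of rank `m` to one of rank `m + 1`. -/
theorem tendsto_zero_of_linear_recurrence {E : Type*} [NormedAddCommGroup E] [NormedSpace ℂ E]
    {μ : ℂ} (hμ : ‖μ‖ < 1) {u y : ℕ → E} (hu : ∀ k, u (k + 1) = μ • u k + y k)
    (hy : Tendsto y atTop (𝓝 0)) (hb : ∃ C, ∀ k, ‖u k‖ ≤ C) :
    Tendsto u atTop (𝓝 0) := by
  obtain ⟨C, hC⟩ := hb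
  rw [Metric.tendsto_atTop] at hy ⊢
  have hC0 : 0 ≤ C := (norm_nonneg _).trans (hC 0)
  intro ε hε
  have hδ : 0 < ε * (1 - ‖μ‖) / 2 := by
    have := sub_pos.mpr hμ
    positivity
  obtain ⟨K, hK⟩ := hy _ hδ
  have hstep : ∀ m, ‖u (K + m)‖ ≤ ‖μ‖ ^ m * C + ε / 2 := by
    intro m
    induction m with
    | zero => simpa using (hC K).trans (by linarith)
    | succ m ih =>
      have h1 : ‖u (K + m + 1)‖ ≤ ‖μ‖ * ‖u (K + m)‖ + ‖y (K + m)‖ := by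
        rw [hu, ← norm_smul]
        exact norm_add_le _ _
      have h2 : ‖y (K + m)‖ < ε * (1 - ‖μ‖) / 2 := by
        simpa using hK (K + m) (Nat.le_add_right _ _)
      have h3 := mul_le_mul_of_nonneg_left ih (norm_nonneg μ)
      rw [← add_assoc, pow_succ]
      nlinarith
  have hpow : Tendsto (fun m => ‖μ‖ ^ m * C) atTop (𝓝 0) := by
    simpa using (tendsto_pow_atTop_nhds_zero_of_lt_one (norm_nonneg μ) hμ).mul_const C
  obtain ⟨m₀, hm₀⟩ := (hpow.eventually (gt_mem_nhds (half_pos hε))).exists_forall_of_atTop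
  refine ⟨K + m₀, fun k hk => ?_⟩
  obtain ⟨m, rfl⟩ := Nat.exists_eq_add_of_le ((Nat.le_add_right K m₀).trans hk)
  have := hm₀ m (by omega)
  rw [dist_zero_right]
  linarith [hstep m]

/-- The powers of an operator that does not increase the norm converge pointwise if its only
eigenvalue of modulus `1` is `1`. It suffices to check this on each generalized eigenspace. -/
theorem exists_tendsto_pow_apply {E : Type*} [NormedAddCommGroup E] [NormedSpace ℂ E]
    [FiniteDimensional ℂ E] (f : Module.End ℂ E) (hf : ∀ x, ‖f x‖ ≤ ‖x‖)
    (hμ : ∀ μ, f.HasEigenvalue μ → ‖μ‖ = 1 → μ = 1) (x : E) :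
    ∃ y, Tendsto (fun k : ℕ => (f ^ k) x) atTop (𝓝 y) := by
  have hpow : ∀ (k : ℕ) x, ‖(f ^ k) x‖ ≤ ‖x‖ := by
    intro k
    induction k with
    | zero => simp
    | succ k ih =>
      intro x
      rw [pow_succ, Module.End.mul_apply]
      exact (ih _).trans (hf x)
  have hx : x ∈ ⨆ μ : ℂ, f.maxGenEigenspace μ := by
    rw [Module.End.iSup_maxGenEigenspace_eq_top]
    trivial
  refine Submodule.iSup_induction _ (motive := fun x => ∃ y, Tendsto (fun k : ℕ => (f ^ k) x)
    atTop (𝓝 y)) hx ?_ ⟨0, by simp⟩ ?_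
  · intro μ x hx
    by_cases hx0 : x = 0
    · exact ⟨0, by simp [hx0]⟩
    have hev : f.HasEigenvalue μ := by
      refine (Module.End.hasUnifEigenvalue_iff_hasUnifEigenvalue_one (k := ⊤) (by simp)).mp ?_
      intro h
      have hx' : x ∈ f.genEigenspace μ ⊤ := hx
      rw [h] at hx'
      exact hx0 (by simpa using hx')
    obtain ⟨m, hm⟩ := (Module.End.mem_maxGenEigenspace f μ x).mp hx
    have hle : ‖μ‖ ≤ 1 := by
      obtain ⟨v, hv⟩ := hev.exists_hasEigenvector
      have h1 := hf v
      rw [hv.apply_eq_smul, norm_smul] at h1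
      have h2 : 0 < ‖v‖ := norm_pos_iff.mpr hv.2
      nlinarith
    rcases hle.lt_or_eq with hlt | heq
    · refine ⟨0, ?_⟩
      clear hx hx0
      induction m generalizing x with
      | zero => simp_all
      | succ m ih =>
        have hy := ih (x := (f - μ • 1) x) (by
          rw [← Module.End.mul_apply, ← pow_succ]; exact hm)
        refine tendsto_zero_of_linear_recurrence hlt (fun k => ?_) hy ⟨‖x‖, fun k => hpow k x⟩
        simp [pow_succ, map_sub]
    · obtain rfl := hμ μ hev heq
      -- A Jordan chain of length two at `1` would make the powers grow linearly.
      have hker : ∀ z, (f - 1) ((f - 1) z) = 0 → (f - 1) z = 0 := by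
        intro z hz
        have hfix : ∀ k : ℕ, (f ^ k) z = z + (k : ℂ) • (f - 1) z := by
          intro k
          induction k with
          | zero => simp
          | succ k ih =>
            have hfz : f ((f - 1) z) = (f - 1) z := by
              rw [← sub_eq_zero]; simpa using hz
            rw [pow_succ', Module.End.mul_apply, ih, map_add, map_smul, hfz]
            simp only [LinearMap.sub_apply, Module.End.one_apply]
            push_cast
            module
        by_contra hne
        have hpos : 0 < ‖(f - 1) z‖ := norm_pos_iff.mpr hne
        obtain ⟨k, hk⟩ := exists_nat_gt (2 * ‖z‖ / ‖(f - 1) z‖)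
        rw [div_lt_iff₀ hpos] at hk
        have h1 : ‖(k : ℂ) • (f - 1) z‖ ≤ 2 * ‖z‖ := by
          have : (k : ℂ) • (f - 1) z = (f ^ k) z - z := by rw [hfix]; abel
          rw [this]
          linarith [norm_sub_le ((f ^ k) z) z, hpow k z]
        rw [norm_smul] at h1
        simp only [Complex.norm_natCast] at h1
        linarith
      have h1 : (f - 1) x = 0 := by
        clear hx hx0
        rw [one_smul] at hm
        induction m with
        | zero => simp_all
        | succ m ih =>
          rcases m with _ | m
          · simpa using hm
          · refine ih ?_
            rw [pow_succ', Module.End.mul_apply]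
            apply hker
            rw [pow_succ', pow_succ'] at hm
            exact hm
      refine ⟨x, ?_⟩
      have hfx : f x = x := by rw [← sub_eq_zero]; simpa using h1
      have : ∀ k : ℕ, (f ^ k) x = x := by
        intro k
        induction k with
        | zero => simp
        | succ k ih => rw [pow_succ, Module.End.mul_apply, hfx, ih]
      simp [this]
  · rintro x y ⟨a, ha⟩ ⟨b, hb⟩
    exact ⟨a + b, by simpa using ha.add hb⟩

variable {V : Type*} [Fintype V] [DecidableEq V]

theorem norm_mulVec_le_of_rowStochastic {P : Matrix V V ℝ} (hP : P ∈ Matrix.rowStochastic ℝ V)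
    (x : V → ℂ) : ‖(P.map Complex.ofReal).mulVec x‖ ≤ ‖x‖ := by
  rw [pi_norm_le_iff_of_nonneg (norm_nonneg _)]
  intro i
  calc ‖∑ j, (P i j : ℂ) * x j‖ ≤ ∑ j, ‖(P i j : ℂ) * x j‖ := norm_sum_le _ _
    _ ≤ ∑ j, P i j * ‖x‖ := by
        refine Finset.sum_le_sum fun j _ => ?_
        rw [norm_mul, Complex.norm_real, Real.norm_of_nonneg (hP.1 i j)]
        exact mul_le_mul_of_nonneg_left (norm_le_pi_norm x j) (hP.1 i j)
    _ = ‖x‖ := by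
        rw [← Finset.sum_mul, (Matrix.mem_rowStochastic_iff_sum.mp hP).2 i, one_mul]

theorem tendsto_pow_powLimit {P : Matrix V V ℝ} (hP : P ∈ Matrix.rowStochastic ℝ V)
    (hproper : IsProper P) : Tendsto (fun k : ℕ => P ^ k) atTop (𝓝 (powLimit P)) := by
  apply tendsto_nhds_limUnder
  set f : Module.End ℂ (V → ℂ) := Matrix.toLin' (P.map Complex.ofReal) with hf
  have hconv := exists_tendsto_pow_apply f
    (fun x => by simpa [hf] using norm_mulVec_le_of_rowStochastic hP x)
    (fun μ hμ => hproper μ (by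
      rw [← Matrix.spectrum_toLin']
      exact Module.End.hasEigenvalue_iff_mem_spectrum.mp hμ))
  choose y hy using fun j => hconv (Pi.single j 1)
  refine ⟨Matrix.of fun i j => (y j i).re, ?_⟩
  refine tendsto_pi_nhds.mpr fun i => tendsto_pi_nhds.mpr fun j => ?_
  have h1 := (Complex.continuous_re.tendsto _).comp (tendsto_pi_nhds.mp (hy j) i)
  refine h1.congr fun k => ?_
  have h2 : (P.map Complex.ofReal) ^ k = (P ^ k).map Complex.ofReal :=
    (map_pow (Complex.ofRealHom.mapMatrix) P k).symm
  simp [hf, ← Matrix.toLin'_pow, h2]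

end PowerConvergence

/-! ### Properties of the power limit -/

section Limit

variable {V : Type*} [Fintype V] [DecidableEq V] {P E : Matrix V V ℝ}

theorem limit_mem_rowStochastic (hP : P ∈ Matrix.rowStochastic ℝ V)
    (hE : Tendsto (fun k : ℕ => P ^ k) atTop (𝓝 E)) : E ∈ Matrix.rowStochastic ℝ V := by
  have hent : ∀ i j, Tendsto (fun k : ℕ => (P ^ k) i j) atTop (𝓝 (E i j)) := fun i j =>
    tendsto_pi_nhds.mp (tendsto_pi_nhds.mp hE i) j
  rw [Matrix.mem_rowStochastic_iff_sum]
  refine ⟨fun i j => ge_of_tendsto' (hent i j) fun k => (pow_mem hP k).1 i j, fun i => ?_⟩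
  refine tendsto_nhds_unique (tendsto_finsetSum _ fun j _ => hent i j) ?_
  simp [fun k => (Matrix.mem_rowStochastic_iff_sum.mp (pow_mem hP k)).2 i]

theorem limit_mul (hE : Tendsto (fun k : ℕ => P ^ k) atTop (𝓝 E)) : E * P = E := by
  refine tendsto_nhds_unique ?_ (hE.comp (tendsto_add_atTop_nat 1))
  simpa [Function.comp_def, pow_succ] using hE.mul_const P

theorem mul_limit (hE : Tendsto (fun k : ℕ => P ^ k) atTop (𝓝 E)) : P * E = E := by
  refine tendsto_nhds_unique ?_ (hE.comp (tendsto_add_atTop_nat 1))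
  simpa [Function.comp_def, pow_succ'] using hE.const_mul P

theorem vecMul_limit (hE : Tendsto (fun k : ℕ => P ^ k) atTop (𝓝 E)) {y : V → ℝ}
    (hy : Matrix.vecMul y P = y) : Matrix.vecMul y E = y := by
  have hpow : ∀ k : ℕ, Matrix.vecMul y (P ^ k) = y := by
    intro k
    induction k with
    | zero => simp
    | succ k ih => rw [pow_succ, ← Matrix.vecMul_vecMul, ih, hy]
  have hc : Continuous fun M : Matrix V V ℝ => Matrix.vecMul y M := by fun_prop
  refine tendsto_nhds_unique ((hc.tendsto E).comp hE) ?_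
  simp [Function.comp_def, hpow]

end Limit

/-! ### Irreducible stochastic matrices -/

section Irreducible

variable {V : Type*} [Fintype V] [DecidableEq V] {Q : Matrix V V ℝ}

/-- A harmonic vector of an irreducible stochastic matrix is constant: the set where it attains its
maximum is closed under predecessors. -/
theorem eq_of_mulVec_eq_self (hQ : Q ∈ Matrix.rowStochastic ℝ V)
    (hconn : ∀ u v, Reachable (commDigraph Q) u v) {x : V → ℝ} (hx : Q.mulVec x = x) (u v : V) :
    x u = x v := by
  have : Nonempty V := ⟨u⟩
  obtain ⟨m, hm⟩ := Finite.exists_max x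
  suffices h : ∀ w, x w = x m by rw [h u, h v]
  intro w
  refine Relation.ReflTransGen.head_induction_on (motive := fun w _ => x w = x m) (hconn w m) rfl ?_
  intro a b hab _ hb
  have hsum : ∑ k, Q b k * (x m - x k) = 0 := by
    have h1 : ∑ k, Q b k * x k = x m := hb ▸ congrFun hx b
    simp only [mul_sub, Finset.sum_sub_distrib, ← Finset.sum_mul]
    rw [(Matrix.mem_rowStochastic_iff_sum.mp hQ).2 b, h1]
    ring
  have h2 := (Finset.sum_eq_zero_iff_of_nonneg fun k _ =>
    mul_nonneg (hQ.1 b k) (sub_nonneg.mpr (hm k))).mp hsum a (Finset.mem_univ a)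
  rcases mul_eq_zero.mp h2 with h3 | h3
  · exact absurd h3 (ne_of_gt hab)
  · linarith

/-- Positivity of a nonnegative left fixed vector propagates to predecessors. -/
theorem pos_of_vecMul_eq_self (hQ : Q ∈ Matrix.rowStochastic ℝ V)
    (hconn : ∀ u v, Reachable (commDigraph Q) u v) {y : V → ℝ} (hy0 : ∀ v, 0 ≤ y v)
    (hy : Matrix.vecMul y Q = y) {w : V} (hw : 0 < y w) (v : V) : 0 < y v := by
  refine Relation.ReflTransGen.head_induction_on (motive := fun v _ => 0 < y v) (hconn v w) hw ?_
  intro a b hab _ hb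
  rw [← congrFun hy a]
  have hab' : 0 < Q b a := hab
  exact (mul_pos hb hab').trans_le (Finset.single_le_sum (f := fun k => y k * Q k a)
    (fun k _ => mul_nonneg (hy0 k) (hQ.1 k a)) (Finset.mem_univ b))

theorem limit_row_pos (hQ : Q ∈ Matrix.rowStochastic ℝ V)
    (hconn : ∀ u v, Reachable (commDigraph Q) u v) {E : Matrix V V ℝ}
    (hE : Tendsto (fun k : ℕ => Q ^ k) atTop (𝓝 E)) (u v : V) : 0 < E u v := by
  have hst := limit_mem_rowStochastic hQ hE
  have hrow : Matrix.vecMul (E u) Q = E u := congrFun (limit_mul hE) u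
  obtain ⟨w, hw⟩ : ∃ w, 0 < E u w := by
    by_contra! h
    have := (Matrix.mem_rowStochastic_iff_sum.mp hst).2 u
    linarith [Finset.sum_nonpos fun w (_ : w ∈ Finset.univ) => h w]
  exact pos_of_vecMul_eq_self hQ hconn (hst.1 u) hrow hw v

theorem limit_eq_vecMulVec (hQ : Q ∈ Matrix.rowStochastic ℝ V)
    (hconn : ∀ u v, Reachable (commDigraph Q) u v) {E : Matrix V V ℝ}
    (hE : Tendsto (fun k : ℕ => Q ^ k) atTop (𝓝 E)) (r : V) :
    E = Matrix.vecMulVec 1 (E r) := by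
  ext u v
  simp only [Matrix.vecMulVec_apply, Pi.one_apply, one_mul]
  refine eq_of_mulVec_eq_self hQ hconn (x := fun w => E w v) ?_ u r
  ext w
  exact congrFun (congrFun (mul_limit hE) w) v

end Irreducible

/-! ### The Markov chain tree theorem -/

section MarkovChainTree

variable {V : Type*}

/-- The iterates of `f` lead from every vertex to `r`. -/
def FlowsTo (f : V → V) (r : V) : Prop := ∀ v, ∃ k : ℕ, f^[k] v = r

/-- Whether all vertices flow to `r` does not depend on the value of the map at `r`. -/
theorem FlowsTo.update_root [DecidableEq V] {f : V → V} {r : V} (hf : FlowsTo f r) (s : V) :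
    FlowsTo (Function.update f r s) r := by
  intro v
  obtain ⟨k, hk⟩ := hf v
  induction k generalizing v with
  | zero => exact ⟨0, hk⟩
  | succ k ih =>
    by_cases hv : v = r
    · exact ⟨0, hv⟩
    · obtain ⟨m, hm⟩ := ih (f v) hk
      exact ⟨m + 1, by simpa [Function.update_of_ne hv] using hm⟩

theorem FlowsTo.trans {f : V → V} {r s : V} (hf : FlowsTo f r) (h : ∃ k : ℕ, f^[k] r = s) :
    FlowsTo f s := by
  intro v
  obtain ⟨k, hk⟩ := hf v
  obtain ⟨m, hm⟩ := h
  exact ⟨m + k, by rw [Function.iterate_add_apply, hk, hm]⟩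

/-- If all vertices flow to `l`, then `l` lies on the unique cycle of `f`, and exactly one vertex
of that cycle is mapped to `l`. -/
theorem FlowsTo.existsUnique_pred {f : V → V} {l : V} (hf : FlowsTo f l) :
    ∃! k, FlowsTo f k ∧ f k = l := by
  obtain ⟨m, hm⟩ := hf (f l)
  rw [← Function.iterate_succ_apply] at hm
  have hper : l ∈ Function.periodicPts f := ⟨m + 1, m.succ_pos, hm⟩
  refine ⟨f^[m] l, ⟨hf.trans ⟨m, rfl⟩, by rwa [← Function.iterate_succ_apply' f]⟩, ?_⟩
  rintro k ⟨hk, hkl⟩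
  -- `k` is again a cyclic vertex, and `f` is injective on cyclic vertices.
  obtain ⟨a, ha⟩ := hk l
  have hmem : ∀ j : ℕ, f^[j] l ∈ Function.periodicPts f := fun j => by
    refine ⟨m + 1, m.succ_pos, ?_⟩
    exact (show Function.IsPeriodicPt f (m + 1) l from hm).apply_iterate j
  refine (Function.bijOn_periodicPts f).injOn (ha ▸ hmem a) (hmem m) ?_
  rw [hkl, ← Function.iterate_succ_apply' f, hm]

theorem IsSpanningOutTree.root_unique {G : Digraph V} {A : Finset (V × V)} {r s : V}
    (hr : IsSpanningOutTree G A r) (hs : IsSpanningOutTree G A s) : r = s := by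
  by_contra h
  obtain ⟨u, hu, -⟩ := hr.2.2.1 s (Ne.symm h)
  exact hs.2.1 u hu

variable [Fintype V]

theorem totalTreeWeight_eq_sum (Q : Matrix V V ℝ) :
    totalTreeWeight Q = ∑ r, rootedTreeWeight Q r := by
  classical
  simp only [totalTreeWeight, rootedTreeWeight, Finset.sum_filter]
  rw [Finset.sum_comm]
  refine Finset.sum_congr rfl fun A _ => ?_
  by_cases h : ∃ r, IsSpanningOutTree (commDigraph Q) A r
  · obtain ⟨r, hr⟩ := h
    rw [if_pos ⟨r, hr⟩, Finset.sum_eq_single r, if_pos hr]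
    · intro s _ hs
      exact if_neg fun h => hs (h.root_unique hr)
    · simp
  · rw [if_neg h, Finset.sum_eq_zero]
    intro r _
    exact if_neg fun hr => h ⟨r, hr⟩

variable [DecidableEq V]

open Classical in
/-- The total weight of the maps that flow to `r`, where the weight of the map `f` is the product of
the entries `Q v (f v)` over all vertices `v`, the root included. -/
noncomputable def flowWeight (Q : Matrix V V ℝ) (r : V) : ℝ :=
  ∑ f : V → V with FlowsTo f r, ∏ v, Q v (f v)

open Classical in
/-- The total weight of the maps that fix `r` and flow to `r`, the factor of the root being
omitted. Such maps are the parent maps of the spanning trees rooted at `r`. -/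
noncomputable def parentWeight (Q : Matrix V V ℝ) (r : V) : ℝ :=
  ∑ f : V → V with f r = r ∧ FlowsTo f r, ∏ v ∈ Finset.univ.erase r, Q v (f v)

open Classical in
/-- The maps flowing to `r` that send `r` to `s` are the trees rooted at `r` with one more arc. -/
theorem sum_flowsTo_root_eq (Q : Matrix V V ℝ) (r s : V) :
    ∑ f : V → V with FlowsTo f r ∧ f r = s, ∏ v, Q v (f v) = parentWeight Q r * Q r s := by
  rw [parentWeight, Finset.sum_mul]
  refine Finset.sum_bij' (fun f _ => Function.update f r r) (fun f _ => Function.update f r s)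
    ?_ ?_ ?_ ?_ ?_
  · intro f hf
    simp only [Finset.mem_filter, Finset.mem_univ, true_and] at hf ⊢
    exact ⟨by simp, hf.1.update_root r⟩
  · intro f hf
    simp only [Finset.mem_filter, Finset.mem_univ, true_and] at hf ⊢
    exact ⟨hf.2.update_root s, by simp⟩
  · intro f hf
    simp only [Finset.mem_filter, Finset.mem_univ, true_and] at hf
    simp [← hf.2]
  · intro f hf
    simp only [Finset.mem_filter, Finset.mem_univ, true_and] at hf
    simp [hf.1]
  · intro f hf
    simp only [Finset.mem_filter, Finset.mem_univ, true_and] at hf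
    rw [← Finset.prod_erase_mul _ _ (Finset.mem_univ r), hf.2]
    congr 1
    refine Finset.prod_congr rfl fun v hv => ?_
    rw [Function.update_of_ne (Finset.ne_of_mem_erase hv)]

/-- The value at the root is free, and the entries of the row of the root sum to one. -/
theorem flowWeight_eq_parentWeight {Q : Matrix V V ℝ} (hQ : Q ∈ Matrix.rowStochastic ℝ V) (r : V) :
    flowWeight Q r = parentWeight Q r := by
  classical
  rw [flowWeight, ← Finset.sum_fiberwise _ fun f => f r]
  simp only [Finset.filter_filter, sum_flowsTo_root_eq, ← Finset.mul_sum]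
  rw [(Matrix.mem_rowStochastic_iff_sum.mp hQ).2 r, mul_one]

/-- The maps flowing to `l` are classified by the predecessor `k` of `l` on the cycle: they flow to
`k` as well and send `k` to `l`. -/
theorem flowWeight_eq_sum (Q : Matrix V V ℝ) (l : V) :
    flowWeight Q l = ∑ k, parentWeight Q k * Q k l := by
  classical
  simp only [← sum_flowsTo_root_eq, Finset.sum_filter]
  rw [flowWeight, Finset.sum_comm, Finset.sum_filter]
  refine Finset.sum_congr rfl fun f _ => ?_
  by_cases hf : FlowsTo f l
  · obtain ⟨k, hk, huniq⟩ := hf.existsUnique_pred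
    rw [if_pos hf, Finset.sum_eq_single k, if_pos hk]
    · intro j _ hj
      exact if_neg fun h => hj (huniq j h)
    · simp
  · rw [if_neg hf, Finset.sum_eq_zero]
    intro k _
    exact if_neg fun h => hf (h.1.trans ⟨1, h.2⟩)

/-- The Markov chain tree theorem: the rooted tree weights form a stationary vector. -/
theorem vecMul_parentWeight {Q : Matrix V V ℝ} (hQ : Q ∈ Matrix.rowStochastic ℝ V) :
    Matrix.vecMul (parentWeight Q) Q = parentWeight Q := by
  ext l
  rw [← flowWeight_eq_parentWeight hQ l, flowWeight_eq_sum]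
  rfl

/-- The set of arcs `(f v, v)`, over all `v ≠ r`, of a parent map `f`. -/
def parentArcs (f : V → V) (r : V) : Finset (V × V) :=
  (Finset.univ.erase r).image fun v => (f v, v)

theorem mem_parentArcs {f : V → V} {r u v : V} : (u, v) ∈ parentArcs f r ↔ v ≠ r ∧ f v = u := by
  simp [parentArcs]

theorem treeWeight_parentArcs (Q : Matrix V V ℝ) (f : V → V) (r : V) :
    treeWeight Q (parentArcs f r) = ∏ v ∈ Finset.univ.erase r, Q v (f v) := by
  rw [treeWeight, parentArcs, Finset.prod_image fun a _ b _ h => congrArg Prod.snd h]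
  rfl

theorem isSpanningOutTree_parentArcs {Q : Matrix V V ℝ} {f : V → V} {r : V} (hf : FlowsTo f r)
    (hpos : ∀ v, v ≠ r → 0 < Q v (f v)) :
    IsSpanningOutTree (commDigraph Q) (parentArcs f r) r := by
  refine ⟨?_, fun u h => (mem_parentArcs.mp h).1 rfl, fun v hv => ?_, fun v => ?_⟩
  · rintro ⟨u, v⟩ h
    obtain ⟨hv, rfl⟩ := mem_parentArcs.mp h
    exact hpos v hv
  · exact ⟨f v, mem_parentArcs.mpr ⟨hv, rfl⟩, fun u hu => (mem_parentArcs.mp hu).2.symm⟩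
  · obtain ⟨k, hk⟩ := hf v
    induction k generalizing v with
    | zero => exact hk ▸ .refl
    | succ k ih =>
      by_cases hv : v = r
      · exact hv ▸ .refl
      · exact (ih (f v) hk).tail (mem_parentArcs.mpr ⟨hv, rfl⟩)

theorem IsSpanningOutTree.exists_parentArcs {G : Digraph V} {A : Finset (V × V)} {r : V}
    (hA : IsSpanningOutTree G A r) :
    ∃ f : V → V, (f r = r ∧ FlowsTo f r) ∧ parentArcs f r = A := by
  obtain ⟨-, hroot, huniq, hreach⟩ := hA
  choose! g hg hg' using huniq
  have hval : ∀ u v, (u, v) ∈ A → v ≠ r ∧ g v = u := by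
    intro u v h
    have hv : v ≠ r := by rintro rfl; exact hroot u h
    exact ⟨hv, (hg' v hv u h).symm⟩
  have hne : ∀ v, v ≠ r → Function.update g r r v = g v := fun v hv => Function.update_of_ne hv _ _
  refine ⟨Function.update g r r, ⟨by simp, fun v => ?_⟩, ?_⟩
  · induction hreach v with
    | refl => exact ⟨0, rfl⟩
    | tail _ huv ih =>
      obtain ⟨k, hk⟩ := ih
      obtain ⟨hv, hgv⟩ := hval _ _ huv
      exact ⟨k + 1, by rw [Function.iterate_succ_apply, hne _ hv, hgv, hk]⟩
  · ext ⟨u, v⟩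
    rw [mem_parentArcs]
    constructor
    · rintro ⟨hv, rfl⟩
      rw [hne v hv]
      exact hg v hv
    · intro h
      obtain ⟨hv, hgv⟩ := hval u v h
      exact ⟨hv, by rw [hne v hv, hgv]⟩

/-- Maps that are not parent maps of spanning out-trees of the communication digraph use an arc that
is absent, and so have weight zero. -/
theorem rootedTreeWeight_eq_parentWeight {Q : Matrix V V ℝ} (hQ : ∀ u v, 0 ≤ Q u v) (r : V) :
    rootedTreeWeight Q r = parentWeight Q r := by
  classical
  rw [rootedTreeWeight, parentWeight]
  symm
  refine Finset.sum_bij_ne_zero (fun f _ _ => parentArcs f r) ?_ ?_ ?_ ?_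
  · intro f hf hne
    simp only [Finset.mem_filter, Finset.mem_univ, true_and] at hf ⊢
    refine isSpanningOutTree_parentArcs hf.2 fun v hv => (hQ v (f v)).lt_of_ne' ?_
    exact Finset.prod_ne_zero_iff.mp hne v (by simp [hv])
  · intro f hf _ g hg _ h
    simp only [Finset.mem_filter, Finset.mem_univ, true_and] at hf hg
    ext v
    by_cases hv : v = r
    · rw [hv, hf.1, hg.1]
    · exact (mem_parentArcs.mp (h ▸ mem_parentArcs.mpr ⟨hv, rfl⟩ : (f v, v) ∈ parentArcs g r)).2.symm
  · intro A hA hne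
    simp only [Finset.mem_filter, Finset.mem_univ, true_and] at hA
    obtain ⟨f, hf, rfl⟩ := hA.exists_parentArcs
    exact ⟨f, by simpa using hf, by rwa [← treeWeight_parentArcs], rfl⟩
  · intro f _ _
    rw [treeWeight_parentArcs]

/-- Breadth-first search: in a digraph all of whose vertices are reachable from `r`, each vertex
other than `r` has a predecessor at smaller distance from `r`. -/
theorem exists_isSpanningOutTree {Q : Matrix V V ℝ} {r : V}
    (hconn : ∀ v, Reachable (commDigraph Q) r v) :
    ∃ A, IsSpanningOutTree (commDigraph Q) A r := by
  classical
  -- `D k` is the set of the end points of the walks of length `k` from `r`.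
  let D : ℕ → V → Prop := fun k => Nat.rec (motive := fun _ => V → Prop) (fun v => v = r)
    (fun _ S v => ∃ u, S u ∧ (commDigraph Q).Adj u v) k
  have hex : ∀ v, ∃ k, D k v := by
    intro v
    induction hconn v with
    | refl => exact ⟨0, rfl⟩
    | tail _ huv ih =>
      obtain ⟨k, hk⟩ := ih
      exact ⟨k + 1, _, hk, huv⟩
  have hpred : ∀ v : V, v ≠ r → ∃ u : V, Nat.find (hex u) < Nat.find (hex v) ∧
      (commDigraph Q).Adj u v := by
    intro v hv
    have hs := Nat.find_spec (hex v)
    generalize Nat.find (hex v) = d at hs ⊢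
    cases d with
    | zero => exact absurd hs hv
    | succ d =>
      obtain ⟨u, hu, huv⟩ := hs
      exact ⟨u, Nat.lt_succ_of_le (Nat.find_min' (hex u) hu), huv⟩
  choose! f hlt hadj using hpred
  refine ⟨parentArcs f r, isSpanningOutTree_parentArcs (fun v => ?_) hadj⟩
  induction hd : Nat.find (hex v) using Nat.strong_induction_on generalizing v with
  | _ d ih =>
    by_cases hv : v = r
    · exact ⟨0, hv⟩
    · obtain ⟨k, hk⟩ := ih _ (hd ▸ hlt v hv) (f v) rfl
      exact ⟨k + 1, hk⟩

theorem rootedTreeWeight_pos {Q : Matrix V V ℝ} {r : V}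
    (hconn : ∀ v, Reachable (commDigraph Q) r v) : 0 < rootedTreeWeight Q r := by
  classical
  have hpos : ∀ A, IsSpanningOutTree (commDigraph Q) A r → 0 < treeWeight Q A := fun A hA =>
    Finset.prod_pos fun a ha => hA.1 a ha
  obtain ⟨A, hA⟩ := exists_isSpanningOutTree hconn
  refine Finset.sum_pos (fun B hB => hpos B ?_) ⟨A, by simpa using hA⟩
  simpa using hB

/-- The normalized rooted tree weights are the stationary distribution. -/
theorem rootedTreeWeight_eq {Q : Matrix V V ℝ} (hQ : Q ∈ Matrix.rowStochastic ℝ V) {π : V → ℝ}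
    (hlim : Tendsto (fun k : ℕ => Q ^ k) atTop (𝓝 (Matrix.vecMulVec 1 π))) (l : V) :
    rootedTreeWeight Q l = totalTreeWeight Q * π l := by
  rw [totalTreeWeight_eq_sum]
  simp only [rootedTreeWeight_eq_parentWeight hQ.1]
  have h := congrFun (vecMul_limit hlim (vecMul_parentWeight hQ)) l
  rw [← h]
  simp [Matrix.vecMul, dotProduct, Matrix.vecMulVec_apply, Finset.sum_mul]

end MarkovChainTree

/-! ### The Kirchhoff matrix -/

section Kirchhoff

variable {V : Type*} [Fintype V] [DecidableEq V]

open Classical in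
theorem kirchhoff_eq_one_sub {P : Matrix V V ℝ} (hP : P ∈ Matrix.rowStochastic ℝ V) :
    kirchhoff P = 1 - P := by
  have hoff : ∀ i j, (if (commDigraph P).Adj j i then -arcWeight P j i else 0) = -P i j := by
    intro i j
    split_ifs with h
    · rfl
    · have : ¬ 0 < P i j := h
      linarith [hP.1 i j]
  ext i j
  simp only [kirchhoff, hoff, Matrix.of_apply, Matrix.sub_apply, Matrix.one_apply]
  split_ifs with h
  · subst h
    have h1 := (Matrix.mem_rowStochastic_iff_sum.mp hP).2 i
    rw [← Finset.sum_erase_add _ _ (Finset.mem_univ i)] at h1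
    rw [Finset.sum_neg_distrib]
    linarith
  · simp

theorem vecMul_kirchhoff_eq_zero_iff {P : Matrix V V ℝ} (hP : P ∈ Matrix.rowStochastic ℝ V)
    {y : V → ℝ} : Matrix.vecMul y (kirchhoff P) = 0 ↔ Matrix.vecMul y P = y := by
  rw [kirchhoff_eq_one_sub hP, Matrix.vecMul_sub, Matrix.vecMul_one, sub_eq_zero, eq_comm]

end Kirchhoff

namespace BicomponentNumbering

variable {n ν : ℕ} {P : Matrix (Fin n) (Fin n) ℝ} (N : BicomponentNumbering P ν)

/-! ### The block structure and the power limit -/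

section Blocks

theorem c_eq_of_pos (hbasic : ∀ v, IsBasic (commDigraph P) v) {g h : Fin n} (hgh : 0 < P g h) :
    N.c h = N.c g :=
  (N.eq_iff h g).mpr (hbasic g h g hgh ⟨.refl, .refl⟩)

theorem apply_eq_zero (hP : P ∈ Matrix.rowStochastic ℝ (Fin n))
    (hbasic : ∀ v, IsBasic (commDigraph P) v) {g h : Fin n} (hgh : N.c h ≠ N.c g) : P g h = 0 :=
  le_antisymm (not_lt.mp fun hpos => hgh (N.c_eq_of_pos hbasic hpos)) (hP.1 g h)

theorem pow_apply_eq_zero (hP : P ∈ Matrix.rowStochastic ℝ (Fin n))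
    (hbasic : ∀ v, IsBasic (commDigraph P) v) (k : ℕ) {g h : Fin n} (hgh : N.c h ≠ N.c g) :
    (P ^ k) g h = 0 := by
  induction k generalizing h with
  | zero => exact Matrix.one_apply_ne fun e => hgh (e ▸ rfl)
  | succ k ih =>
    rw [pow_succ, Matrix.mul_apply]
    refine Finset.sum_eq_zero fun x _ => ?_
    by_cases hx : N.c x = N.c g
    · rw [N.apply_eq_zero hP hbasic (hx ▸ hgh), mul_zero]
    · rw [ih hx, zero_mul]

theorem sum_class {M : Type*} [AddCommMonoid M] (i : Fin ν) (F : Fin n → M)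
    (hF : ∀ g, N.c g ≠ i → F g = 0) : ∑ v : N.Class i, F v = ∑ g, F g := by
  rw [← Finset.sum_subtype (Finset.univ.filter fun g => N.c g = i) (by simp) F,
    Finset.sum_filter_of_ne]
  intro g _ hg
  by_contra hc
  exact hg (hF g hc)

theorem block_pow (hP : P ∈ Matrix.rowStochastic ℝ (Fin n))
    (hbasic : ∀ v, IsBasic (commDigraph P) v) (i : Fin ν) (k : ℕ) :
    N.block i ^ k = (P ^ k).submatrix Subtype.val Subtype.val := by
  induction k with
  | zero => simp [Matrix.submatrix_one _ Subtype.val_injective]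
  | succ k ih =>
    ext u v
    rw [pow_succ, pow_succ, ih, Matrix.submatrix_apply, Matrix.mul_apply, Matrix.mul_apply]
    refine N.sum_class i (fun x => (P ^ k) u x * P x v) fun g hg => ?_
    rw [N.pow_apply_eq_zero hP hbasic k (by rwa [u.2]), zero_mul]

theorem block_mem_rowStochastic (hP : P ∈ Matrix.rowStochastic ℝ (Fin n))
    (hbasic : ∀ v, IsBasic (commDigraph P) v) (i : Fin ν) :
    N.block i ∈ Matrix.rowStochastic ℝ (N.Class i) := by
  rw [Matrix.mem_rowStochastic_iff_sum]
  refine ⟨fun u v => hP.1 u v, fun u => ?_⟩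
  rw [← (Matrix.mem_rowStochastic_iff_sum.mp hP).2 u]
  exact N.sum_class i (fun x => P u x) fun g hg => N.apply_eq_zero hP hbasic (by rwa [u.2])

/-- A path that ends in a basic bicomponent stays in it, so each block is irreducible. -/
theorem reachable_block (hbasic : ∀ v, IsBasic (commDigraph P) v) (i : Fin ν) (u v : N.Class i) :
    Reachable (commDigraph (N.block i)) u v := by
  have huv : Reachable (commDigraph P) u v := ((N.eq_iff u v).mp (u.2.trans v.2.symm)).1
  suffices h : ∀ w, Reachable (commDigraph P) w v → ∃ hw : N.c w = i,
      Reachable (commDigraph (N.block i)) ⟨w, hw⟩ v from (h u huv).2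
  intro w hw
  refine Relation.ReflTransGen.head_induction_on (motive := fun w _ => ∃ hw : N.c w = i,
      Reachable (commDigraph (N.block i)) ⟨w, hw⟩ v) hw ⟨v.2, .refl⟩ ?_
  rintro a b hab - ⟨hb, hbv⟩
  have ha := (N.c_eq_of_pos hbasic hab).trans hb
  exact ⟨ha, hbv.head (show (commDigraph (N.block i)).Adj ⟨a, ha⟩ ⟨b, hb⟩ from hab)⟩

theorem tendsto_block_pow (hP : P ∈ Matrix.rowStochastic ℝ (Fin n)) (hproper : IsProper P)
    (hbasic : ∀ v, IsBasic (commDigraph P) v) (i : Fin ν) :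
    Tendsto (fun k : ℕ => N.block i ^ k) atTop
      (𝓝 ((powLimit P).submatrix Subtype.val Subtype.val)) := by
  simp only [N.block_pow hP hbasic]
  have hc : Continuous fun M : Matrix (Fin n) (Fin n) ℝ =>
      M.submatrix (Subtype.val : N.Class i → Fin n) (Subtype.val : N.Class i → Fin n) := by fun_prop
  exact (hc.tendsto _).comp (tendsto_pow_powLimit hP hproper)

theorem tendsto_block_pow_pi (hP : P ∈ Matrix.rowStochastic ℝ (Fin n)) (hproper : IsProper P)
    (hbasic : ∀ v, IsBasic (commDigraph P) v) (i : Fin ν) :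
    Tendsto (fun k : ℕ => N.block i ^ k) atTop (𝓝 (Matrix.vecMulVec 1 (N.pi i))) := by
  have hlim := N.tendsto_block_pow hP hproper hbasic i
  have h := limit_eq_vecMulVec (N.block_mem_rowStochastic hP hbasic i)
    (N.reachable_block hbasic i) (tendsto_nhds_limUnder ⟨_, hlim⟩) ⟨N.first i, N.c_first i⟩
  change _ = Matrix.vecMulVec 1 (N.pi i) at h
  rw [← h]
  exact tendsto_nhds_limUnder ⟨_, hlim⟩

theorem pi_pos (hP : P ∈ Matrix.rowStochastic ℝ (Fin n)) (hproper : IsProper P)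
    (hbasic : ∀ v, IsBasic (commDigraph P) v) (i : Fin ν) (v : N.Class i) : 0 < N.pi i v := by
  simpa [Matrix.vecMulVec_apply] using limit_row_pos (N.block_mem_rowStochastic hP hbasic i)
    (N.reachable_block hbasic i) (N.tendsto_block_pow_pi hP hproper hbasic i) v v

theorem piTilde_of_ne {i : Fin ν} {g : Fin n} (h : N.c g ≠ i) : N.piTilde i g = 0 := dif_neg h

theorem piTilde_coe (i : Fin ν) (v : N.Class i) : N.piTilde i v = N.pi i v := dif_pos v.2

theorem piTilde_pos (hP : P ∈ Matrix.rowStochastic ℝ (Fin n)) (hproper : IsProper P)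
    (hbasic : ∀ v, IsBasic (commDigraph P) v) (g : Fin n) : 0 < N.piTilde (N.c g) g :=
  N.piTilde_coe (N.c g) ⟨g, rfl⟩ ▸ N.pi_pos hP hproper hbasic (N.c g) ⟨g, rfl⟩

/-- The rows of the power limit are the stationary distributions of the blocks. -/
theorem powLimit_row (hP : P ∈ Matrix.rowStochastic ℝ (Fin n)) (hproper : IsProper P)
    (hbasic : ∀ v, IsBasic (commDigraph P) v) (g : Fin n) : powLimit P g = N.piTilde (N.c g) := by
  ext h
  by_cases hgh : N.c h = N.c g
  · have h1 := tendsto_nhds_unique (N.tendsto_block_pow hP hproper hbasic (N.c g))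
      (N.tendsto_block_pow_pi hP hproper hbasic (N.c g))
    have h2 := congrFun (congrFun h1 ⟨g, rfl⟩) ⟨h, hgh⟩
    simp only [Matrix.submatrix_apply, Matrix.vecMulVec_apply, Pi.one_apply, one_mul] at h2
    rw [h2, ← N.piTilde_coe]
  · rw [N.piTilde_of_ne hgh]
    refine tendsto_nhds_unique
      (tendsto_pi_nhds.mp (tendsto_pi_nhds.mp (tendsto_pow_powLimit hP hproper) g) h) ?_
    simp [N.pow_apply_eq_zero hP hbasic _ hgh]

theorem sum_piTilde (hP : P ∈ Matrix.rowStochastic ℝ (Fin n)) (hproper : IsProper P)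
    (hbasic : ∀ v, IsBasic (commDigraph P) v) (i : Fin ν) : ∑ g, N.piTilde i g = 1 := by
  have h := (Matrix.mem_rowStochastic_iff_sum.mp
    (limit_mem_rowStochastic hP (tendsto_pow_powLimit hP hproper))).2 (N.first i)
  rwa [N.powLimit_row hP hproper hbasic, N.c_first] at h

theorem vecMul_piTilde (hP : P ∈ Matrix.rowStochastic ℝ (Fin n)) (hproper : IsProper P)
    (hbasic : ∀ v, IsBasic (commDigraph P) v) (i : Fin ν) :
    Matrix.vecMul (N.piTilde i) P = N.piTilde i := by
  have h := congrFun (limit_mul (tendsto_pow_powLimit hP hproper)) (N.first i)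
  have hrow : powLimit P (N.first i) = N.piTilde i := by
    rw [N.powLimit_row hP hproper hbasic, N.c_first]
  rwa [Matrix.mul_apply_eq_vecMul, hrow] at h

/-- A left fixed vector of `P` is a combination of the stationary distributions of the blocks. -/
theorem exists_coeff_of_vecMul_eq_self (hP : P ∈ Matrix.rowStochastic ℝ (Fin n))
    (hproper : IsProper P) (hbasic : ∀ v, IsBasic (commDigraph P) v) {y : Fin n → ℝ}
    (hy : Matrix.vecMul y P = y) :
    ∃ s : Fin ν → ℝ, y = ∑ i, s i • N.piTilde i := by
  refine ⟨fun i => ∑ g with N.c g = i, y g, ?_⟩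
  ext h
  rw [← congrFun (vecMul_limit (tendsto_pow_powLimit hP hproper) hy) h]
  simp only [Finset.sum_apply, Pi.smul_apply, smul_eq_mul, Matrix.vecMul, dotProduct,
    N.powLimit_row hP hproper hbasic, Finset.sum_mul]
  rw [← Finset.sum_fiberwise _ N.c]
  refine Finset.sum_congr rfl fun i _ => Finset.sum_congr rfl fun g hg => ?_
  rw [(Finset.mem_filter.mp hg).2]

end Blocks

/-! ### The weight vector and the orthogonal projection -/

section Weights

open Matrix

/-- The squared Euclidean norm of the stationary distribution of the `i`th block. -/
noncomputable def normSq (i : Fin ν) : ℝ := N.piTilde i ⬝ᵥ N.piTilde i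

/-- The common value of `π̃ⁱ ⬝ᵥ α` over all `i`, where `α` is the weight vector. -/
noncomputable def scale : ℝ := (∑ i, (N.normSq i)⁻¹)⁻¹

/-- The weight vector: the convex combination of the stationary distributions of the blocks whose
coefficients are inversely proportional to the squared norms of these distributions. -/
noncomputable def weight : Fin n → ℝ := ∑ i, (N.scale * (N.normSq i)⁻¹) • N.piTilde i

theorem piTilde_dotProduct_of_ne {i j : Fin ν} (hij : i ≠ j) : N.piTilde i ⬝ᵥ N.piTilde j = 0 := by
  refine Finset.sum_eq_zero fun g _ => ?_
  by_cases h : N.c g = i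
  · rw [N.piTilde_of_ne (i := j) (h ▸ hij), mul_zero]
  · rw [N.piTilde_of_ne h, zero_mul]

theorem piTilde_dotProduct_sum (i : Fin ν) (s : Fin ν → ℝ) :
    N.piTilde i ⬝ᵥ (∑ j, s j • N.piTilde j) = s i * N.normSq i := by
  rw [dotProduct_sum, Finset.sum_eq_single i]
  · rw [dotProduct_smul, smul_eq_mul, normSq]
  · intro j _ hj
    rw [dotProduct_smul, N.piTilde_dotProduct_of_ne hj.symm, smul_zero]
  · simp

theorem weight_apply (g : Fin n) :
    N.weight g = N.scale * (N.normSq (N.c g))⁻¹ * N.piTilde (N.c g) g := by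
  rw [weight, Finset.sum_apply, Finset.sum_eq_single (N.c g)]
  · rfl
  · intro j _ hj
    simp [N.piTilde_of_ne hj.symm]
  · simp

theorem normSq_pos (hP : P ∈ Matrix.rowStochastic ℝ (Fin n)) (hproper : IsProper P)
    (hbasic : ∀ v, IsBasic (commDigraph P) v) (i : Fin ν) :
    0 < N.normSq i := by
  refine Finset.sum_pos' (fun g _ => mul_self_nonneg _) ⟨N.first i, Finset.mem_univ _, ?_⟩
  have h := N.piTilde_pos hP hproper hbasic (N.first i)
  rw [N.c_first] at h
  exact mul_pos h h

theorem sum_inv_normSq_pos [NeZero n] (hP : P ∈ Matrix.rowStochastic ℝ (Fin n))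
    (hproper : IsProper P) (hbasic : ∀ v, IsBasic (commDigraph P) v) :
    0 < ∑ i, (N.normSq i)⁻¹ :=
  Finset.sum_pos (fun i _ => inv_pos.mpr (N.normSq_pos hP hproper hbasic i))
    ⟨N.c 0, Finset.mem_univ _⟩

theorem scale_pos [NeZero n] (hP : P ∈ Matrix.rowStochastic ℝ (Fin n)) (hproper : IsProper P)
    (hbasic : ∀ v, IsBasic (commDigraph P) v) : 0 < N.scale :=
  inv_pos.mpr (N.sum_inv_normSq_pos hP hproper hbasic)

theorem weight_pos [NeZero n] (hP : P ∈ Matrix.rowStochastic ℝ (Fin n)) (hproper : IsProper P)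
    (hbasic : ∀ v, IsBasic (commDigraph P) v) (g : Fin n) :
    0 < N.weight g := by
  rw [weight_apply]
  exact mul_pos (mul_pos (N.scale_pos hP hproper hbasic)
    (inv_pos.mpr (N.normSq_pos hP hproper hbasic _))) (N.piTilde_pos hP hproper hbasic g)

theorem piTilde_dotProduct_weight (hP : P ∈ Matrix.rowStochastic ℝ (Fin n)) (hproper : IsProper P)
    (hbasic : ∀ v, IsBasic (commDigraph P) v) (i : Fin ν) :
    N.piTilde i ⬝ᵥ N.weight = N.scale := by
  rw [weight, N.piTilde_dotProduct_sum, mul_assoc,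
    inv_mul_cancel₀ (N.normSq_pos hP hproper hbasic i).ne', mul_one]

/-- On the region of convergence to consensus, the functional `α` gives the consensus value. -/
theorem weight_dotProduct [NeZero n] (hP : P ∈ Matrix.rowStochastic ℝ (Fin n))
    (hproper : IsProper P) (hbasic : ∀ v, IsBasic (commDigraph P) v)
    {x : Fin n → ℝ} {t : ℝ} (hx : ∀ i, N.piTilde i ⬝ᵥ x = t) : N.weight ⬝ᵥ x = t := by
  simp only [weight, sum_dotProduct, smul_dotProduct, hx, smul_eq_mul]
  rw [← Finset.sum_mul, ← Finset.mul_sum, scale,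
    inv_mul_cancel₀ (N.sum_inv_normSq_pos hP hproper hbasic).ne', one_mul]

theorem sum_weight [NeZero n] (hP : P ∈ Matrix.rowStochastic ℝ (Fin n)) (hproper : IsProper P)
    (hbasic : ∀ v, IsBasic (commDigraph P) v) :
    ∑ g, N.weight g = 1 := by
  rw [← dotProduct_one]
  refine N.weight_dotProduct hP hproper hbasic fun i => ?_
  rw [dotProduct_one, N.sum_piTilde hP hproper hbasic]

theorem vecMul_weight (hP : P ∈ Matrix.rowStochastic ℝ (Fin n)) (hproper : IsProper P)
    (hbasic : ∀ v, IsBasic (commDigraph P) v) : N.weight ᵥ* P = N.weight := by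
  simp only [weight, sum_vecMul, smul_vecMul, N.vecMul_piTilde hP hproper hbasic]

theorem powLimit_mulVec_apply (hP : P ∈ Matrix.rowStochastic ℝ (Fin n)) (hproper : IsProper P)
    (hbasic : ∀ v, IsBasic (commDigraph P) v) (x : Fin n → ℝ) (g : Fin n) :
    (powLimit P *ᵥ x) g = N.piTilde (N.c g) ⬝ᵥ x := by
  rw [mulVec, N.powLimit_row hP hproper hbasic]

theorem weight_mem_consensusRegion (hP : P ∈ Matrix.rowStochastic ℝ (Fin n)) (hproper : IsProper P)
    (hbasic : ∀ v, IsBasic (commDigraph P) v) :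
    WithLp.toLp 2 N.weight ∈ consensusRegion P := by
  intro g h
  simp only [N.powLimit_mulVec_apply hP hproper hbasic,
    N.piTilde_dotProduct_weight hP hproper hbasic]

theorem projMatrix_mulVec (P : Matrix (Fin n) (Fin n) ℝ) (x : Fin n → ℝ) :
    projMatrix P *ᵥ x = ((consensusRegion P).starProjection (WithLp.toLp 2 x)).ofLp := by
  have h := Matrix.ofLp_toEuclideanCLM (𝕜 := ℝ) (projMatrix P) (WithLp.toLp 2 x)
  rw [← h, projMatrix, StarAlgEquiv.apply_symm_apply]

/-- Since `α` lies in the region of convergence, pairing with `α` does not see the projection. -/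
theorem weight_dotProduct_projMatrix_mulVec (hP : P ∈ Matrix.rowStochastic ℝ (Fin n))
    (hproper : IsProper P) (hbasic : ∀ v, IsBasic (commDigraph P) v) (x : Fin n → ℝ) :
    N.weight ⬝ᵥ (projMatrix P *ᵥ x) = N.weight ⬝ᵥ x := by
  have h := Submodule.inner_starProjection_left_eq_right (consensusRegion P)
    (WithLp.toLp 2 N.weight) (WithLp.toLp 2 x)
  rw [Submodule.starProjection_eq_self_iff.mpr
    (N.weight_mem_consensusRegion hP hproper hbasic)] at h
  rw [projMatrix_mulVec]
  simp only [EuclideanSpace.inner_eq_star_dotProduct, star_trivial] at h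
  rw [dotProduct_comm, ← h, dotProduct_comm]

theorem resultingMatrix_eq [NeZero n] (hP : P ∈ Matrix.rowStochastic ℝ (Fin n))
    (hproper : IsProper P) (hbasic : ∀ v, IsBasic (commDigraph P) v) :
    resultingMatrix P = vecMulVec 1 N.weight := by
  refine Matrix.ext_of_mulVec_single fun j => ?_
  ext g
  generalize (Pi.single j 1 : Fin n → ℝ) = x
  have hmem : ∀ h : Fin n, (powLimit P *ᵥ (projMatrix P *ᵥ x)) h =
      (powLimit P *ᵥ (projMatrix P *ᵥ x)) g := by
    have hS := Submodule.starProjection_apply_mem (consensusRegion P) (WithLp.toLp 2 x)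
    intro h
    rw [projMatrix_mulVec]
    exact hS h g
  have hdot : ∀ i, N.piTilde i ⬝ᵥ (projMatrix P *ᵥ x) =
      (powLimit P *ᵥ (projMatrix P *ᵥ x)) g := by
    intro i
    rw [← hmem (N.first i), N.powLimit_mulVec_apply hP hproper hbasic, N.c_first]
  rw [resultingMatrix, ← mulVec_mulVec, ← N.weight_dotProduct hP hproper hbasic hdot,
    N.weight_dotProduct_projMatrix_mulVec hP hproper hbasic, vecMulVec_mulVec]
  simp

end Weights

/-! ### The matrix `Z` and its inverse -/

section Inverse

open Matrix

theorem first_zero [NeZero n] : N.first (N.c 0) = 0 :=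
  le_antisymm (Finset.min'_le _ _ (by simp)) (Fin.zero_le _)

theorem c_zero [NeZero n] : (N.c 0 : ℕ) = 0 := by
  have hν : 0 < ν := (Nat.zero_le _).trans_lt (N.c 0).isLt
  obtain ⟨v, hv⟩ := N.surjective ⟨0, hν⟩
  have h : N.c 0 ≤ N.c v := N.monotone (Fin.zero_le v)
  rw [hv] at h
  exact Nat.le_zero.mp h

theorem vecMul_Z_zero [NeZero n] (y : Fin n → ℝ) : (y ᵥ* N.Z) 0 = ∑ g, y g := by
  simp [vecMul, dotProduct, Z, X, N.first_zero, N.c_zero]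

theorem vecMul_Z_first (y : Fin n → ℝ) (i : Fin ν) (hi : (i : ℕ) ≠ 0) :
    (y ᵥ* N.Z) (N.first i) = y ⬝ᵥ N.q i := by
  simp [vecMul, dotProduct, Z, N.c_first, hi]

theorem vecMul_Z_of_ne (y : Fin n → ℝ) {j : Fin n} (hj : j ≠ N.first (N.c j)) :
    (y ᵥ* N.Z) j = (y ᵥ* kirchhoff P) j := by
  simp [vecMul, dotProduct, Z, X, hj]

theorem eq_zero_of_first_of_c_eq_zero [NeZero n] {j : Fin n} (hj : j = N.first (N.c j))
    (h0 : (N.c j : ℕ) = 0) : j = 0 := by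
  rw [hj, ← N.first_zero]
  congr 1
  exact Fin.ext (h0.trans N.c_zero.symm)

/-- `αᵀ Z` is the first unit vector, so `α` is the first row of `Z⁻¹` once `Z` is invertible. -/
theorem weight_vecMul_Z [NeZero n] (hP : P ∈ Matrix.rowStochastic ℝ (Fin n)) (hproper : IsProper P)
    (hbasic : ∀ v, IsBasic (commDigraph P) v) :
    N.weight ᵥ* N.Z = Pi.single 0 1 := by
  ext j
  by_cases hj0 : j = 0
  · rw [hj0, N.vecMul_Z_zero, N.sum_weight hP hproper hbasic, Pi.single_eq_same]
  rw [Pi.single_eq_of_ne hj0]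
  by_cases hj : j = N.first (N.c j)
  · rw [hj, N.vecMul_Z_first _ _ fun h => hj0 (N.eq_zero_of_first_of_c_eq_zero hj h),
      dotProduct_comm, q, sub_dotProduct, N.piTilde_dotProduct_weight hP hproper hbasic,
      N.piTilde_dotProduct_weight hP hproper hbasic, sub_self]
  · rw [N.vecMul_Z_of_ne _ hj,
      (vecMul_kirchhoff_eq_zero_iff hP).mpr (N.vecMul_weight hP hproper hbasic), Pi.zero_apply]

/-- The columns of a block of the Kirchhoff matrix sum to zero, so the columns that `Z` discards
are recovered from the ones that it keeps. -/
theorem sum_kirchhoff_class (hP : P ∈ Matrix.rowStochastic ℝ (Fin n))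
    (hbasic : ∀ v, IsBasic (commDigraph P) v) (g : Fin n) (i : Fin ν) :
    ∑ j with N.c j = i, kirchhoff P g j = 0 := by
  simp only [kirchhoff_eq_one_sub hP, Matrix.sub_apply, Finset.sum_sub_distrib, Matrix.one_apply]
  by_cases hg : N.c g = i
  · rw [Finset.sum_filter_of_ne (f := fun j => P g j), Finset.sum_ite_eq, if_pos (by simpa),
      (Matrix.mem_rowStochastic_iff_sum.mp hP).2, sub_self]
    intro j _ hj
    by_contra h
    exact hj (N.apply_eq_zero hP hbasic (hg ▸ h))
  · rw [Finset.sum_ite_eq, if_neg (by simpa), Finset.sum_eq_zero, sub_self]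
    intro j hj
    exact N.apply_eq_zero hP hbasic ((Finset.mem_filter.mp hj).2 ▸ Ne.symm hg)

theorem vecMul_kirchhoff_eq_zero_of_vecMul_Z (hP : P ∈ Matrix.rowStochastic ℝ (Fin n))
    (hbasic : ∀ v, IsBasic (commDigraph P) v) {y : Fin n → ℝ} (hy : y ᵥ* N.Z = 0) :
    y ᵥ* kirchhoff P = 0 := by
  have hne : ∀ j, j ≠ N.first (N.c j) → (y ᵥ* kirchhoff P) j = 0 := fun j hj => by
    rw [← N.vecMul_Z_of_ne y hj, hy, Pi.zero_apply]
  ext j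
  by_cases hj : j = N.first (N.c j)
  · have hsum : ∑ k with N.c k = N.c j, (y ᵥ* kirchhoff P) k = 0 := by
      simp only [vecMul, dotProduct]
      rw [Finset.sum_comm]
      simp only [← Finset.mul_sum, N.sum_kirchhoff_class hP hbasic, mul_zero,
        Finset.sum_const_zero]
    rw [Finset.sum_eq_single j] at hsum
    · exact hsum
    · intro k hk hkj
      refine hne k fun h => hkj ?_
      rw [h, (Finset.mem_filter.mp hk).2, ← hj]
    · simp
  · exact hne j hj

theorem isUnit_det_Z [NeZero n] (hP : P ∈ Matrix.rowStochastic ℝ (Fin n)) (hproper : IsProper P)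
    (hbasic : ∀ v, IsBasic (commDigraph P) v) :
    IsUnit N.Z.det := by
  rw [isUnit_iff_ne_zero]
  intro hdet
  obtain ⟨y, hy0, hy⟩ := Matrix.exists_vecMul_eq_zero_iff.mpr hdet
  refine hy0 ?_
  have hfix := (vecMul_kirchhoff_eq_zero_iff hP).mp
    (N.vecMul_kirchhoff_eq_zero_of_vecMul_Z hP hbasic hy)
  obtain ⟨s, hs⟩ := N.exists_coeff_of_vecMul_eq_self hP hproper hbasic hfix
  -- The columns `q i` force `s i * normSq i` to be independent of `i`.
  have hdot : ∀ i, N.piTilde i ⬝ᵥ y = s i * N.normSq i := fun i => by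
    rw [hs, N.piTilde_dotProduct_sum]
  have hstep : ∀ m (hm : m < ν), N.piTilde ⟨m, hm⟩ ⬝ᵥ y = N.piTilde (N.c 0) ⬝ᵥ y := by
    intro m hm
    induction m with
    | zero => congr 2; exact Fin.ext N.c_zero.symm
    | succ m ih =>
      have h := N.vecMul_Z_first y ⟨m + 1, hm⟩ m.succ_ne_zero
      rw [hy, Pi.zero_apply, dotProduct_comm, q, sub_dotProduct] at h
      rw [← ih (by omega)]
      exact (sub_eq_zero.mp h.symm).symm
  have hconst : ∀ i, N.piTilde i ⬝ᵥ y = N.piTilde (N.c 0) ⬝ᵥ y := fun i => hstep i i.isLt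
  -- The column of ones makes the coefficients `s i` sum to zero.
  have hsum : ∑ g, y g = 0 := by rw [← N.vecMul_Z_zero, hy, Pi.zero_apply]
  have hs_sum : ∑ i, s i = 0 := by
    rw [← hsum, hs]
    simp only [Finset.sum_apply, Pi.smul_apply, smul_eq_mul]
    rw [Finset.sum_comm]
    simp only [← Finset.mul_sum, N.sum_piTilde hP hproper hbasic, mul_one]
  -- The `s i` are a common multiple of the positive numbers `(normSq i)⁻¹`, so the factor vanishes.
  have hs_eq : ∀ i, s i = (N.piTilde (N.c 0) ⬝ᵥ y) * (N.normSq i)⁻¹ := fun i => by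
    rw [← hconst i, hdot, mul_assoc, mul_inv_cancel₀ (N.normSq_pos hP hproper hbasic i).ne',
      mul_one]
  have hzero : N.piTilde (N.c 0) ⬝ᵥ y = 0 := by
    simp only [hs_eq, ← Finset.mul_sum] at hs_sum
    exact (mul_eq_zero.mp hs_sum).resolve_right (N.sum_inv_normSq_pos hP hproper hbasic).ne'
  rw [hs]
  simp [hs_eq, hzero]

theorem weight_eq_row [NeZero n] (hP : P ∈ Matrix.rowStochastic ℝ (Fin n)) (hproper : IsProper P)
    (hbasic : ∀ v, IsBasic (commDigraph P) v) :
    N.weight = N.Z⁻¹.row 0 := by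
  have h := congrArg (· ᵥ* N.Z⁻¹) (N.weight_vecMul_Z hP hproper hbasic)
  simp only [vecMul_vecMul, mul_nonsing_inv _ (N.isUnit_det_Z hP hproper hbasic), vecMul_one,
    single_one_vecMul] at h
  exact h

theorem sum_inv_Z_row [NeZero n] (hP : P ∈ Matrix.rowStochastic ℝ (Fin n)) (hproper : IsProper P)
    (hbasic : ∀ v, IsBasic (commDigraph P) v)
    {r : Fin n} (hr : r ≠ 0) : ∑ j, N.Z⁻¹ r j = 0 := by
  have h := N.vecMul_Z_zero (N.Z⁻¹ r)
  rw [← h, ← Matrix.mul_apply_eq_vecMul,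
    nonsing_inv_mul _ (N.isUnit_det_Z hP hproper hbasic), Matrix.one_apply_ne hr]

/-- The tree quotient `β_i` is the reciprocal of the squared norm of the stationary distribution. -/
theorem beta_eq (hP : P ∈ Matrix.rowStochastic ℝ (Fin n)) (hproper : IsProper P)
    (hbasic : ∀ v, IsBasic (commDigraph P) v) (i : Fin ν) :
    N.beta i = (N.normSq i)⁻¹ := by
  have hst := N.block_mem_rowStochastic hP hbasic i
  have hlim := N.tendsto_block_pow_pi hP hproper hbasic i
  have ht : totalTreeWeight (N.block i) ≠ 0 := by
    have h := rootedTreeWeight_pos (N.reachable_block hbasic i ⟨N.first i, N.c_first i⟩)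
    rw [rootedTreeWeight_eq hst hlim] at h
    exact fun h0 => by simp [h0] at h
  have hnorm : N.normSq i = ∑ v, N.pi i v ^ 2 := by
    rw [normSq, dotProduct, ← N.sum_class i _ fun g hg => by rw [N.piTilde_of_ne hg, mul_zero]]
    exact Finset.sum_congr rfl fun v _ => by rw [N.piTilde_coe, sq]
  rw [beta, hnorm]
  simp only [rootedTreeWeight_eq hst hlim, mul_pow, ← Finset.mul_sum]
  rw [div_mul_eq_div_div, div_self (pow_ne_zero 2 ht), one_div]

theorem weight_div_weight [NeZero n] (hP : P ∈ Matrix.rowStochastic ℝ (Fin n))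
    (hproper : IsProper P) (hbasic : ∀ v, IsBasic (commDigraph P) v)
    (g h : Fin n) : N.weight g / N.weight h =
      (N.beta (N.c g) * N.piTilde (N.c g) g) / (N.beta (N.c h) * N.piTilde (N.c h) h) := by
  rw [weight_apply, weight_apply, N.beta_eq hP hproper hbasic, N.beta_eq hP hproper hbasic,
    mul_assoc, mul_assoc, mul_div_mul_left _ _ (N.scale_pos hP hproper hbasic).ne']

end Inverse

end BicomponentNumbering

end Consensus

theorem theorem3 {n ν : ℕ} [NeZero n] (P : Matrix (Fin n) (Fin n) ℝ)
    (hP : P ∈ Matrix.rowStochastic ℝ (Fin n)) (hproper : Consensus.IsProper P)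
    (N : Consensus.BicomponentNumbering P ν)
    (hbasic : ∀ v, Consensus.IsBasic (Consensus.commDigraph P) v) :
    -- the limits `P^∞` and `P_i^∞ = 𝟏 (π^i)ᵀ` exist
    Tendsto (fun k : ℕ => P ^ k) atTop (𝓝 (Consensus.powLimit P)) ∧
    (∀ i, Tendsto (fun k : ℕ => N.block i ^ k) atTop (𝓝 (Matrix.vecMulVec 1 (N.pi i)))) ∧
    -- `Z` is nonsingular
    IsUnit N.Z.det ∧
    -- the weight vector `α` exists (it is determined by the first equation)
    ∃ α : Fin n → ℝ, Consensus.resultingMatrix P = Matrix.vecMulVec 1 α ∧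
      -- 1
      α = N.Z⁻¹.row 0 ∧
      -- 2
      (∀ g, 0 < α g) ∧ ∑ g, α g = 1 ∧ (∀ r, r ≠ 0 → ∑ j, N.Z⁻¹ r j = 0) ∧
      -- 3
      ∀ g h, α g / α h =
        (N.beta (N.c g) * N.piTilde (N.c g) g) / (N.beta (N.c h) * N.piTilde (N.c h) h) := by
  exact ⟨Consensus.tendsto_pow_powLimit hP hproper, N.tendsto_block_pow_pi hP hproper hbasic,
    N.isUnit_det_Z hP hproper hbasic, N.weight, N.resultingMatrix_eq hP hproper hbasic,
    N.weight_eq_row hP hproper hbasic, N.weight_pos hP hproper hbasic,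
    N.sum_weight hP hproper hbasic, fun _ hr => N.sum_inv_Z_row hP hproper hbasic hr,
    N.weight_div_weight hP hproper hbasic⟩
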